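/- Let $\lambda_\ell,\lambda_e>0$ and let $\Pi_\ell,\Pi_e\subset\mathbb{R}^2$ be independent homogeneous Poisson point processes (legitimate nodes and eavesdroppers) with densities $\lambda_\ell$ and $\lambda_e$. Let $P>0$ be the transmit power, $\sigma^2>0$ the common noise power of nodes and eavesdroppers, and let the power gain $g:(0,\infty)\to\mathbb{R}$ be continuous and strictly decreasing with $g(r)\to 0$ as $r\to\infty$ (path loss only). The basic Poisson $i\mathcal{S}$-graph is the random directed graph with vertex set $\Pi_\ell$ in which there is an edge from $x$ to $y\neq x$ if and only if the maximum secrecy rate $$R_s(x,y)=\Bigl[\log_2\Bigl(1+\tfrac{P\,g(|x-y|)}{\sigma^2}\Bigr)-\log_2\Bigl(1+\tfrac{P\,g(|x-e^*|)}{\sigma^2}\Bigr)\Bigr]^+,\qquad e^*=\operatorname*{argmax}_{e\in\Pi_e} P\,g(|x-e|),$$ is positive (secrecy rate threshold $0$). Let $N_{\mathrm{out}}$ be the out-degree of a typical node of this graph. Then $N_{\mathrm{out}}$ is geometric: $$\mathbb{P}\{N_{\mathrm{out}}=n\}=\Bigl(\frac{\lambda_\ell}{\lambda_\ell+\lambda_e}\Bigr)^{n}\,\frac{\lambda_e}{\lambda_\ell+\lambda_e},\qquad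 n\ge 0 .$$ Consequently $\mathbb{E}\{N_{\mathrm{out}}\}=\lambda_\ell/\lambda_e$, and the probability that a typical node is out-isolated (has no outgoing edge) is $\lambda_e/(\lambda_\ell+\lambda_e)$. Here the typical node is understood in the sense of Palm theory: for every Borel set $B\subset\mathbb{R}^2$ with $0<|B|<\infty$, the Palm expectation of a quantity $h(x)$ attached to the nodes $x$ is $\frac{1}{\lambda_\ell|B|}\,\mathbb{E}\sum_{x\in\Pi_\ell\cap B}h(x)$, and Palm probabilities are the Palm expectations of indicators. The same three formulas hold for the out-degree of the node at the origin in the graph with vertex set $\Pi_\ell\cup\{0\}$ and eavesdroppers $\Pi_e$. -/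

import Mathlib

open MeasureTheory ProbabilityTheory Set Filter Topology
open scoped ENNReal

noncomputable section

/-- The space `ℝ^d` with its Euclidean distance. -/
abbrev Space (d : ℕ) : Type := EuclideanSpace ℝ (Fin d)

/-! ### The secrecy graph of a configuration of nodes and eavesdroppers -/

/-- The received power `P_rx(x, y) = P · g(|x - y|)` in an environment with path loss only. -/
def pathLossPower {d : ℕ} (power : ℝ) (g : ℝ → ℝ) (x y : Space d) : ℝ :=
  power * g (dist x y)

/-- The conditions on the power gain `g(r)` as a function of the link length `r > 0`.  The value
at `r = 0` is unconstrained, so that gains with a singularity at the origin are allowed. -/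
structure IsPathLossGain (g : ℝ → ℝ) : Prop where
  continuousOn : ContinuousOn g (Ioi 0)
  strictAntiOn : StrictAntiOn g (Ioi 0)
  tendsto_zero : Tendsto g atTop (𝓝 0)

/-- The power `P_rx(x, e*)` that the strongest eavesdropper `e* = argmax_e P_rx(x, e)` receives
from `x`; it is `0` if there is no eavesdropper. -/
def strongestPower {d : ℕ} (rx : Space d → Space d → ℝ) (eaves : Set (Space d))
    (x : Space d) : ℝ :=
  sSup (rx x '' eaves)

theorem strongestPower_eq {d : ℕ} (rx : Space d → Space d → ℝ) (eaves : Set (Space d))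
    (x e : Space d) (he : e ∈ eaves) (hmax : IsMaxOn (rx x) eaves e) :
    strongestPower rx eaves x = rx x e := by
  refine IsGreatest.csSup_eq ⟨mem_image_of_mem _ he, ?_⟩
  rintro _ ⟨e', he', rfl⟩
  exact hmax he'

/-- The maximum secrecy rate `R_s(x, y)` of the link from `x` to `y`, with noise power `noiseL`
at the legitimate nodes and `noiseE` at the eavesdroppers. -/
def maxSecrecyRate {d : ℕ} (rx : Space d → Space d → ℝ) (noiseL noiseE : ℝ)
    (eaves : Set (Space d)) (x y : Space d) : ℝ :=
  max (Real.logb 2 (1 + rx x y / noiseL) -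
    Real.logb 2 (1 + strongestPower rx eaves x / noiseE)) 0

/-- The intrinsically secure communications graph: its vertices are the legitimate nodes, and
there is an edge from `x` to another node `y` if and only if `R_s(x, y)` exceeds `threshold`. -/
def isGraph {d : ℕ} (rx : Space d → Space d → ℝ) (noiseL noiseE threshold : ℝ)
    (nodes eaves : Set (Space d)) : Digraph nodes where
  Adj x y := x ≠ y ∧ threshold < maxSecrecyRate rx noiseL noiseE eaves x y

/-- The basic graph: path loss only, equal noise powers, and secrecy rate threshold `0`. -/
def basicISGraph {d : ℕ} (power noise : ℝ) (g : ℝ → ℝ) (nodes eaves : Set (Space d)) :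
    Digraph nodes :=
  isGraph (pathLossPower power g) noise noise 0 nodes eaves

/-- The number of edges that leave a vertex. -/
def outDegree {V : Type*} (G : Digraph V) (v : V) : ℕ∞ := {w | G.Adj v w}.encard

/-- No edge leaves the vertex. -/
def OutIsolated {V : Type*} (G : Digraph V) (v : V) : Prop := ∀ w, ¬ G.Adj v w

/-! ### Poisson point processes -/

/-- The number of points of the random set `Φ` in `A`. -/
def pointCount {Ω : Type*} {d : ℕ} (Φ : Ω → Set (Space d)) (A : Set (Space d)) (ω : Ω) : ℕ∞ :=
  (Φ ω ∩ A).encard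

/-- The random set `Φ` is a homogeneous Poisson point process in `ℝ^d` with density `lam`. -/
structure IsHomogeneousPoisson {Ω : Type*} [MeasurableSpace Ω] (P : Measure Ω) {d : ℕ}
    (lam : ℝ) (Φ : Ω → Set (Space d)) : Prop where
  measurable_count : ∀ A : Set (Space d), MeasurableSet A → Measurable (pointCount Φ A)
  hasLaw_count : ∀ A : Set (Space d), MeasurableSet A → volume A ≠ ⊤ →
    HasLaw (pointCount Φ A)
      ((poissonMeasure (lam * (volume A).toReal).toNNReal).map (fun k : ℕ => (k : ℕ∞))) P
  indep_count : ∀ (n : ℕ) (A : Fin n → Set (Space d)), (∀ i, MeasurableSet (A i)) →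
    Pairwise (fun i j => Disjoint (A i) (A j)) → iIndepFun (fun i => pointCount Φ (A i)) P

/-- The σ-algebra on the sample space generated by the point counts of the random set `Φ`. -/
abbrev processSigma {Ω : Type*} {d : ℕ} (Φ : Ω → Set (Space d)) : MeasurableSpace Ω :=
  ⨆ (A : Set (Space d)) (_ : MeasurableSet A), MeasurableSpace.comap (pointCount Φ A) inferInstance

/-- The node and eavesdropper processes of the Poisson model: independent homogeneous Poisson
point processes with densities `lamL` and `lamE`. -/
structure IsPoissonModel {Ω : Type*} [MeasurableSpace Ω] (P : Measure Ω) {d : ℕ}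
    (lamL lamE : ℝ) (nodes eaves : Ω → Set (Space d)) : Prop where
  nodes_poisson : IsHomogeneousPoisson P lamL nodes
  eaves_poisson : IsHomogeneousPoisson P lamE eaves
  indep : Indep (processSigma nodes) (processSigma eaves) P

/-! ### The typical node -/

/-- The Palm expectation of a mark `h` of the points of `Φ`, computed with the window `B`: the
expected sum of the marks of the points in `B`, divided by the expected number `lam · |B|` of
these points. -/
def palmMean {Ω : Type*} [MeasurableSpace Ω] (P : Measure Ω) {d : ℕ} (lam : ℝ)
    (Φ : Ω → Set (Space d)) (B : Set (Space d)) (h : (ω : Ω) → Φ ω → ℝ≥0∞) : ℝ≥0∞ :=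
  (∫⁻ ω, ∑' x : Φ ω, {z : Φ ω | (z : Space d) ∈ B}.indicator (h ω) x ∂P) /
    (ENNReal.ofReal lam * volume B)

/-- The Palm probability that a typical point of `Φ` has the property `p`, computed with the
window `B`. -/
def palmProb {Ω : Type*} [MeasurableSpace Ω] (P : Measure Ω) {d : ℕ} (lam : ℝ)
    (Φ : Ω → Set (Space d)) (B : Set (Space d)) (p : (ω : Ω) → Φ ω → Prop) : ℝ≥0∞ :=
  palmMean P lam Φ B (fun ω => {x : Φ ω | p ω x}.indicator (fun _ => 1))

/-- The basic graph after a node has been added at the origin. -/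
def originGraph {d : ℕ} (power noise : ℝ) (g : ℝ → ℝ) (nodes eaves : Set (Space d)) :
    Digraph ↥(insert (0 : Space d) nodes) :=
  basicISGraph power noise g (insert 0 nodes) eaves

/-- The vertex of `originGraph` at the origin. -/
def originNode {d : ℕ} (nodes : Set (Space d)) : ↥(insert (0 : Space d) nodes) :=
  ⟨0, mem_insert 0 nodes⟩

end

/-! ### The Poisson distribution -/

/-! With equal noise powers, threshold `0` and a strictly decreasing gain, logarithm, noise and
power all cancel: almost surely `x` is joined to `y` exactly when `y` is nearer to `x` than the
nearest eavesdropper (`maxSecrecyRate_pos_iff`). The out-degree is thus the number of other nodes in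
an open disc around `x` whose radius depends only on the eavesdroppers. The area of that disc is
exponential with rate `lamE`; given area `v`, the number of nodes is Poisson with mean `lamL * v`.
Mixing gives the geometric law (`lintegral_poissonMeasure_expMeasure`).

For a typical node the disc moves with the node, so a Mecke formula is needed, while the model
supplies only the laws and independence of counts. For a fixed cell and a fixed set the formula
follows from the size-bias identity `(k + 1) p(k + 1) = r p(k)` (`lintegral_encard_pointsSeeing`).
The window is therefore cut into small cells, and every node of a cell is given one disc, centred at
a reference point of the cell, whose radius takes countably many values. Independence freezes that
radius (`lintegral_comp_of_indep`), and its law does not depend on the centre (`map_infDist_eq`). As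
the mesh shrinks, local finiteness makes the approximate discs eventually contain exactly the right
nodes (`eventually_inter_ball_gridRadius_eq`), and dominated convergence yields the result. The
origin is treated in the same way without cells. Measurability of the degree is obtained only almost
everywhere, from these limits. -/

theorem poissonMeasure_singleton_succ (r : NNReal) (k : ℕ) :
    ((k : ℝ≥0∞) + 1) * poissonMeasure r {k + 1} = r * poissonMeasure r {k} := by
  rw [poissonMeasure_singleton, poissonMeasure_singleton,
    show ((k : ℝ≥0∞) + 1) = ENNReal.ofReal (k + 1) by
      rw [ENNReal.ofReal_add (by positivity) zero_le_one]; simp,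
    show (r : ℝ≥0∞) = ENNReal.ofReal r by simp,
    ← ENNReal.ofReal_mul (by positivity), ← ENNReal.ofReal_mul (by positivity)]
  congr 1
  rw [Nat.factorial_succ]
  push_cast
  field_simp
  ring

theorem tsum_mul_poissonMeasure_singleton (r : NNReal) :
    ∑' k : ℕ, (k : ℝ≥0∞) * poissonMeasure r {k} = r := by
  rw [tsum_eq_zero_add' ENNReal.summable]
  simp only [Nat.cast_zero, zero_mul, zero_add, Nat.cast_add, Nat.cast_one,
    poissonMeasure_singleton_succ]
  rw [ENNReal.tsum_mul_left]
  have h := lintegral_countable' (μ := poissonMeasure r) (fun _ => 1)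
  simp only [one_mul, lintegral_const, measure_univ] at h
  rw [← h, mul_one]

/-- Needed so that an almost everywhere limit of `ℕ∞`-valued counts is a.e. measurable. -/
theorem borelSpace_enat : BorelSpace ℕ∞ := ⟨borel_eq_top_of_countable.symm⟩

theorem measurable_enat_toENNReal : Measurable ((↑) : ℕ∞ → ℝ≥0∞) := measurable_of_countable _

/-- The indicator of the count `n`. -/
noncomputable def atCount (n : ℕ) : ℕ∞ → ℝ≥0∞ := ({(n : ℕ∞)} : Set ℕ∞).indicator 1

theorem measurable_atCount (n : ℕ) : Measurable (atCount n) := measurable_of_countable _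

/-! ### Point counts of a Poisson process -/

section Counts

variable {Ω : Type*} {d : ℕ}

theorem measurable_pointCount_processSigma (Φ : Ω → Set (Space d)) {A : Set (Space d)}
    (hA : MeasurableSet A) : Measurable[processSigma Φ] (pointCount Φ A) :=
  measurable_iff_comap_le.2 (le_iSup₂_of_le A hA le_rfl)

theorem pointCount_union (Φ : Ω → Set (Space d)) {A B : Set (Space d)} (hAB : Disjoint A B) (ω : Ω) :
    pointCount Φ (A ∪ B) ω = pointCount Φ A ω + pointCount Φ B ω := by
  rw [pointCount, inter_union_distrib_left, encard_union_eq
    (hAB.mono inter_subset_right inter_subset_right)]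
  rfl

theorem enat_add_eq_coe_iff (a b : ℕ∞) (n : ℕ) :
    a + b = n ↔ ∃ p ∈ Finset.HasAntidiagonal.antidiagonal n, a = (p.1 : ℕ) ∧ b = (p.2 : ℕ) := by
  constructor
  · intro h
    have ha : a ≠ ⊤ := by rintro rfl; simp at h
    have hb : b ≠ ⊤ := by rintro rfl; simp at h
    lift a to ℕ using ha
    lift b to ℕ using hb
    exact ⟨(a, b), by simpa using by exact_mod_cast h, rfl, rfl⟩
  · rintro ⟨p, hp, rfl, rfl⟩
    exact_mod_cast Finset.HasAntidiagonal.mem_antidiagonal.1 hp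

/-! ### The points that see a given number of other points -/

/-- The points of `S` in `C` that see exactly `n` other points in `A`. -/
def pointsSeeing (S C A : Set (Space d)) (n : ℕ) : Set (Space d) :=
  {x | x ∈ S ∩ C ∧ ((S ∩ A) \ {x}).encard = n}

/-- A point inside `A` does not see itself, so `A` must then hold `n + 1` points; for a point
outside `A` it must hold `n`. This expresses the quantity through counts of fixed sets, hence makes
it measurable. -/
theorem encard_pointsSeeing (S C A : Set (Space d)) (n : ℕ) :
    ((pointsSeeing S C A n).encard : ℝ≥0∞) =
      ((S ∩ (C ∩ A)).encard : ℝ≥0∞) * atCount (n + 1) (S ∩ A).encard +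
      ((S ∩ (C \ A)).encard : ℝ≥0∞) * atCount n (S ∩ A).encard := by
  have hsplit : pointsSeeing S C A n =
      {x | x ∈ S ∩ (C ∩ A) ∧ (S ∩ A).encard = (n + 1 : ℕ)} ∪
      {x | x ∈ S ∩ (C \ A) ∧ (S ∩ A).encard = n} := by
    ext x
    by_cases hx : x ∈ S
    · by_cases hA : x ∈ A
      · have h1 := encard_sdiff_singleton_add_one (mem_inter hx hA)
        have h2 : ((S ∩ A) \ {x}).encard = n ↔ (S ∩ A).encard = (n + 1 : ℕ) := by
          rw [← h1]
          push_cast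
          exact ((ENat.add_left_injective_of_ne_top (n := 1) (by simp)).eq_iff).symm
        simp [pointsSeeing, hx, hA, h2]
      · have h1 : (S ∩ A) \ {x} = S ∩ A := sdiff_singleton_eq_self (fun h => hA h.2)
        simp [pointsSeeing, hx, hA, h1]
    · simp [pointsSeeing, hx]
  have haux : ∀ (T : Set (Space d)) (k : ℕ),
      (({x | x ∈ T ∧ (S ∩ A).encard = k} : Set (Space d)).encard : ℝ≥0∞) =
        (T.encard : ℝ≥0∞) * atCount k (S ∩ A).encard := by
    intro T k
    by_cases h : (S ∩ A).encard = k <;> simp [h, atCount]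
  rw [hsplit, encard_union_eq, ENat.toENNReal_add, haux, haux]
  rw [disjoint_left]
  rintro x ⟨⟨_, _, hx⟩, _⟩ ⟨⟨_, _, hx'⟩, _⟩
  exact hx' hx

theorem measurable_encard_pointsSeeing_processSigma (Φ : Ω → Set (Space d)) {C A : Set (Space d)}
    (hC : MeasurableSet C) (hA : MeasurableSet A) (n : ℕ) :
    Measurable[processSigma Φ] fun ω => ((pointsSeeing (Φ ω) C A n).encard : ℝ≥0∞) := by
  simp_rw [encard_pointsSeeing]
  have h1 := measurable_pointCount_processSigma Φ (hC.inter hA)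
  have h2 := measurable_pointCount_processSigma Φ (hC.diff hA)
  have h3 := measurable_pointCount_processSigma Φ hA
  exact ((measurable_enat_toENNReal.comp h1).mul ((measurable_atCount (n + 1)).comp h3)).add
    ((measurable_enat_toENNReal.comp h2).mul ((measurable_atCount n).comp h3))

variable [mΩ : MeasurableSpace Ω] {P : Measure Ω} {lam : ℝ} {Φ : Ω → Set (Space d)}

/-- The expected number of points of a Poisson process of density `lam` in `A`. -/
noncomputable abbrev meanCount (lam : ℝ) (A : Set (Space d)) : NNReal :=
  (lam * (volume A).toReal).toNNReal

theorem coe_meanCount (hlam : 0 ≤ lam) {A : Set (Space d)} (hA : volume A ≠ ⊤) :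
    (meanCount lam A : ℝ≥0∞) = ENNReal.ofReal lam * volume A := by
  rw [meanCount, ← ENNReal.ofReal, ENNReal.ofReal_mul hlam, ENNReal.ofReal_toReal hA]

namespace IsHomogeneousPoisson

theorem processSigma_le (h : IsHomogeneousPoisson P lam Φ) : processSigma Φ ≤ mΩ :=
  iSup₂_le fun A hA => measurable_iff_comap_le.1 (h.measurable_count A hA)

theorem measure_count_eq (h : IsHomogeneousPoisson P lam Φ) {A : Set (Space d)}
    (hA : MeasurableSet A) (hv : volume A ≠ ⊤) (n : ℕ) :
    P {ω | pointCount Φ A ω = n} = poissonMeasure (meanCount lam A) {n} := by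
  rw [(h.hasLaw_count A hA hv).measure_eq (p := fun k => k = n) (MeasurableSet.of_discrete),
    Measure.map_apply (measurable_of_countable _) MeasurableSet.of_discrete]
  congr 1
  ext k
  simp

theorem measure_count_eq_top (h : IsHomogeneousPoisson P lam Φ) {A : Set (Space d)}
    (hA : MeasurableSet A) (hv : volume A ≠ ⊤) :
    P {ω | pointCount Φ A ω = ⊤} = 0 := by
  rw [(h.hasLaw_count A hA hv).measure_eq (p := fun k => k = ⊤) (MeasurableSet.of_discrete),
    Measure.map_apply (measurable_of_countable _) MeasurableSet.of_discrete]
  convert! measure_empty (μ := poissonMeasure _)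
  ext k
  simp

theorem lintegral_count (h : IsHomogeneousPoisson P lam Φ) (hlam : 0 ≤ lam) {A : Set (Space d)}
    (hA : MeasurableSet A) (hv : volume A ≠ ⊤) :
    ∫⁻ ω, (pointCount Φ A ω : ℝ≥0∞) ∂P = ENNReal.ofReal lam * volume A := by
  have hl := h.hasLaw_count A hA hv
  rw [← lintegral_map' (f := fun k : ℕ∞ => (k : ℝ≥0∞))
    measurable_enat_toENNReal.aemeasurable hl.aemeasurable, hl.map_eq,
    lintegral_map measurable_enat_toENNReal (measurable_of_countable _), lintegral_countable']
  simp only [ENat.toENNReal_coe]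
  rw [tsum_mul_poissonMeasure_singleton, coe_meanCount hlam hv]

theorem indepFun_count (h : IsHomogeneousPoisson P lam Φ) {A B : Set (Space d)}
    (hA : MeasurableSet A) (hB : MeasurableSet B) (hAB : Disjoint A B) :
    IndepFun (pointCount Φ A) (pointCount Φ B) P := by
  have := h.indep_count 2 ![A, B] (by intro i; fin_cases i <;> simpa)
    (by
      intro i j hij
      fin_cases i <;> fin_cases j <;> simp_all [hAB.symm])
  exact this.indepFun (i := 0) (j := 1) (by simp)

end IsHomogeneousPoisson

namespace IsHomogeneousPoisson

theorem lintegral_atCount (h : IsHomogeneousPoisson P lam Φ) {A : Set (Space d)}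
    (hA : MeasurableSet A) (hv : volume A ≠ ⊤) (n : ℕ) :
    ∫⁻ ω, atCount n (pointCount Φ A ω) ∂P = poissonMeasure (meanCount lam A) {n} := by
  rw [← h.measure_count_eq hA hv]
  rw [show {ω | pointCount Φ A ω = n} = pointCount Φ A ⁻¹' {(n : ℕ∞)} from rfl,
    ← lintegral_indicator_one (h.measurable_count _ hA (MeasurableSet.of_discrete (s := {(n : ℕ∞)})))]
  rfl

/-- The sizes of independent point counts convolve. -/
theorem lintegral_mul_atCount_add (h : IsHomogeneousPoisson P lam Φ) {A B : Set (Space d)}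
    (hA : MeasurableSet A) (hB : MeasurableSet B) (hAB : Disjoint A B) (hvA : volume A ≠ ⊤)
    (hvB : volume B ≠ ⊤) (w : ℕ∞ → ℝ≥0∞) (n : ℕ) :
    ∫⁻ ω, w (pointCount Φ A ω) * atCount n (pointCount Φ (A ∪ B) ω) ∂P =
      ∑ p ∈ Finset.HasAntidiagonal.antidiagonal n, w (p.1 : ℕ) *
        (poissonMeasure (meanCount lam A) {p.1} * poissonMeasure (meanCount lam B) {p.2}) := by
  -- If the union holds `n` points, both counts are finite and exactly one pair of the antidiagonal
  -- occurs; otherwise none does.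
  have key : ∀ ω, w (pointCount Φ A ω) * atCount n (pointCount Φ (A ∪ B) ω) =
      ∑ p ∈ Finset.HasAntidiagonal.antidiagonal n, w (p.1 : ℕ) * {ω | pointCount Φ A ω = (p.1 : ℕ) ∧
        pointCount Φ B ω = (p.2 : ℕ)}.indicator 1 ω := by
    intro ω
    by_cases hn : pointCount Φ (A ∪ B) ω = n
    · obtain ⟨p, hp, h1, h2⟩ := (enat_add_eq_coe_iff _ _ _).1
        ((pointCount_union Φ hAB ω).symm.trans hn)
      rw [Finset.sum_eq_single_of_mem p hp]
      · simp [hn, h1, h2, atCount]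
      · intro q _ hqp
        rw [indicator_of_notMem, mul_zero]
        rintro ⟨h1', h2'⟩
        apply hqp
        ext
        · exact_mod_cast h1'.symm.trans h1
        · exact_mod_cast h2'.symm.trans h2
    · rw [atCount, indicator_of_notMem (by simpa using hn), mul_zero, Finset.sum_eq_zero]
      intro p hp
      rw [indicator_of_notMem, mul_zero]
      rintro ⟨h1, h2⟩
      exact hn ((pointCount_union Φ hAB ω).trans
        ((enat_add_eq_coe_iff _ _ _).2 ⟨p, hp, h1, h2⟩))
  have hmeas : ∀ p : ℕ × ℕ, MeasurableSet {ω | pointCount Φ A ω = (p.1 : ℕ) ∧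
      pointCount Φ B ω = (p.2 : ℕ)} := fun p =>
    (h.measurable_count A hA (MeasurableSet.of_discrete (s := {(p.1 : ℕ∞)}))).inter
      (h.measurable_count B hB (MeasurableSet.of_discrete (s := {(p.2 : ℕ∞)})))
  simp_rw [key]
  rw [lintegral_finsetSum]
  · refine Finset.sum_congr rfl fun p _ => ?_
    rw [lintegral_const_mul _ (measurable_one.indicator (hmeas p)),
      lintegral_indicator_one (hmeas p), ← h.measure_count_eq hA hvA, ← h.measure_count_eq hB hvB]
    congr 1
    exact (h.indepFun_count hA hB hAB).measure_inter_preimage_eq_mul {(p.1 : ℕ∞)} {(p.2 : ℕ∞)}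
      MeasurableSet.of_discrete MeasurableSet.of_discrete
  · exact fun p _ => (measurable_one.indicator (hmeas p)).const_mul _

/-- The size-biased law of the counts of a Poisson process. -/
theorem lintegral_count_mul_atCount_succ (h : IsHomogeneousPoisson P lam Φ) (hlam : 0 ≤ lam)
    {A B : Set (Space d)} (hA : MeasurableSet A) (hB : MeasurableSet B) (hAB : Disjoint A B)
    (hvA : volume A ≠ ⊤) (hvB : volume B ≠ ⊤) (n : ℕ) :
    ∫⁻ ω, (pointCount Φ A ω : ℝ≥0∞) * atCount (n + 1) (pointCount Φ (A ∪ B) ω) ∂P =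
      ENNReal.ofReal lam * volume A * poissonMeasure (meanCount lam (A ∪ B)) {n} := by
  have hv : volume (A ∪ B) ≠ ⊤ := measure_union_ne_top hvA hvB
  rw [h.lintegral_mul_atCount_add hA hB hAB hvA hvB (fun k => (k : ℝ≥0∞)) (n + 1),
    ← h.lintegral_atCount (hA.union hB) hv]
  have := h.lintegral_mul_atCount_add hA hB hAB hvA hvB (fun _ => 1) n
  simp only [one_mul] at this
  -- The term with no point in `A` has weight zero; in the others the size-bias identity lowers the
  -- first index by one.
  rw [this, Finset.Nat.antidiagonal_succ, Finset.sum_cons, Finset.sum_map, Finset.mul_sum]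
  simp only [Nat.cast_zero, ENat.toENNReal_zero, zero_mul, zero_add]
  refine Finset.sum_congr rfl fun p _ => ?_
  simp only [Function.Embedding.prodMap, Function.Embedding.coeFn_mk, Prod.map,
    Function.Embedding.refl_apply, Nat.succ_eq_add_one, Nat.cast_add, Nat.cast_one,
    ENat.toENNReal_add, ENat.toENNReal_coe, ENat.toENNReal_one]
  rw [← mul_assoc, poissonMeasure_singleton_succ, coe_meanCount hlam hvA]
  ring

end IsHomogeneousPoisson

/-! ### Mecke's formula for point counts -/

/-- Points of `C ∩ A` contribute by size-biasing, with `A \ C` as the rest of `A`; points of `C \ A`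
are independent of the count in `A`. Both give the same Poisson factor, so the volumes add up to
that of `C`. -/
theorem IsHomogeneousPoisson.lintegral_encard_pointsSeeing (h : IsHomogeneousPoisson P lam Φ)
    (hlam : 0 ≤ lam) {C A : Set (Space d)} (hC : MeasurableSet C) (hA : MeasurableSet A)
    (hvC : volume C ≠ ⊤) (hvA : volume A ≠ ⊤) (n : ℕ) :
    ∫⁻ ω, ((pointsSeeing (Φ ω) C A n).encard : ℝ≥0∞) ∂P =
      ENNReal.ofReal lam * volume C * poissonMeasure (meanCount lam A) {n} := by
  simp_rw [encard_pointsSeeing]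
  have hm : ∀ (A : Set (Space d)), MeasurableSet A →
      Measurable fun ω => ((Φ ω ∩ A).encard : ℝ≥0∞) := fun A hA =>
    measurable_enat_toENNReal.comp (h.measurable_count A hA)
  have hi : ∀ k : ℕ, Measurable fun ω => atCount k (Φ ω ∩ A).encard := fun k =>
    (measurable_atCount k).comp (h.measurable_count A hA)
  rw [lintegral_add_left (f := fun ω => ((Φ ω ∩ (C ∩ A)).encard : ℝ≥0∞) *
    atCount (n + 1) (Φ ω ∩ A).encard) ((hm _ (hC.inter hA)).mul (hi _))]
  have e1 := h.lintegral_count_mul_atCount_succ hlam (hC.inter hA) (hA.diff hC)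
    (disjoint_left.2 fun x hx hx' => hx'.2 hx.1)
    (measure_ne_top_of_subset inter_subset_left hvC)
    (measure_ne_top_of_subset sdiff_subset hvA) n
  have hu : C ∩ A ∪ A \ C = A := by rw [inter_comm, inter_union_sdiff]
  rw [hu] at e1
  have e2 : IndepFun (fun ω => ((Φ ω ∩ (C \ A)).encard : ℝ≥0∞))
      (fun ω => atCount n (Φ ω ∩ A).encard) P :=
    (h.indepFun_count (hC.diff hA) hA disjoint_sdiff_left).comp
      measurable_enat_toENNReal (measurable_atCount n)
  have e3 := lintegral_mul_eq_lintegral_mul_lintegral_of_indepFun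
    (hm _ (hC.diff hA)) (hi n) e2
  have e4 := h.lintegral_atCount hA hvA n
  have e5 := h.lintegral_count hlam (hC.diff hA)
    (measure_ne_top_of_subset sdiff_subset hvC)
  simp only [pointCount] at e4 e5
  rw [e4, e5] at e3
  refine (congrArg₂ (· + ·) e1 e3).trans ?_
  rw [← add_mul, ← mul_add, measure_inter_add_sdiff C hA]

end Counts

/-! ### Integrals over independent σ-algebras -/

/-- Fubini for a countable-valued parameter: on each event `K = k` the integrand is a product of
independent factors. -/
theorem lintegral_comp_of_indep {Ω : Type*} {M₁ M₂ mΩ : MeasurableSpace Ω} {P : Measure Ω}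
    (h₁ : M₁ ≤ mΩ) (h₂ : M₂ ≤ mΩ) (hind : Indep M₁ M₂ P) {G : ℕ → Ω → ℝ≥0∞}
    (hG : ∀ k, Measurable[M₁] (G k)) {K : Ω → ℕ} (hK : Measurable[M₂] K) :
    ∫⁻ ω, G (K ω) ω ∂P = ∫⁻ ω', ∫⁻ ω, G (K ω') ω ∂P ∂P := by
  have hi : ∀ k : ℕ, Measurable[M₂] fun ω => ({k} : Set ℕ).indicator (1 : ℕ → ℝ≥0∞) (K ω) :=
    fun k => (measurable_of_countable (({k} : Set ℕ).indicator (1 : ℕ → ℝ≥0∞))).comp hK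
  have hsum : ∀ (f : ℕ → ℝ≥0∞) (j : ℕ),
      f j = ∑' k, f k * ({k} : Set ℕ).indicator (1 : ℕ → ℝ≥0∞) j := by
    intro f j
    rw [tsum_eq_single j (fun k hk => by simp [hk.symm])]
    simp
  rw [lintegral_congr fun ω => hsum (fun k => G k ω) (K ω),
    lintegral_congr fun ω => hsum (fun k => ∫⁻ ω', G k ω' ∂P) (K ω),
    lintegral_tsum (f := fun k ω => G k ω * ({k} : Set ℕ).indicator (1 : ℕ → ℝ≥0∞) (K ω))
      fun k => (((hG k).mono h₁ le_rfl).mul ((hi k).mono h₂ le_rfl)).aemeasurable,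
    lintegral_tsum fun k => (((hi k).mono h₂ le_rfl).const_mul _).aemeasurable]
  refine tsum_congr fun k => ?_
  rw [lintegral_mul_eq_lintegral_mul_lintegral_of_independent_measurableSpace h₁ h₂ hind
    (hG k) (hi k), lintegral_const_mul _ ((hi k).mono h₂ le_rfl)]

/-! ### A countable partition into small cells -/

/-- The index is the first term of a dense sequence within distance `δ`. -/
theorem exists_measurable_cellIndex {X : Type*} [PseudoMetricSpace X]
    [TopologicalSpace.SeparableSpace X] [Nonempty X] [MeasurableSpace X] [OpensMeasurableSpace X]
    {δ : ℝ} (hδ : 0 < δ) :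
    ∃ (idx : X → ℕ) (c : ℕ → X), Measurable idx ∧ ∀ x, dist x (c (idx x)) < δ := by
  classical
  have hex : ∀ x : X, ∃ k, dist x (TopologicalSpace.denseSeq X k) < δ := fun x =>
    (TopologicalSpace.denseRange_denseSeq X).exists_dist_lt x hδ
  refine ⟨fun x => Nat.find (hex x), TopologicalSpace.denseSeq X, ?_, fun x => Nat.find_spec (hex x)⟩
  exact measurable_find hex fun k => Metric.isOpen_ball.measurableSet

theorem encard_eq_tsum_fiber {X : Type*} (S : Set X) (idx : X → ℕ) :
    (S.encard : ℝ≥0∞) = ∑' z, ((S ∩ idx ⁻¹' {z}).encard : ℝ≥0∞) := by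
  have hS : S = ⋃ z, S ∩ idx ⁻¹' {z} := by
    ext x
    simp
  conv_lhs => rw [hS]
  rw [← ENNReal.tsum_set_one, ENNReal.tsum_biUnion (f := fun _ => 1)]
  · simp_rw [ENNReal.tsum_set_one]
  · intro i _ j _ hij
    exact ((disjoint_singleton.2 hij).preimage idx).mono inter_subset_right inter_subset_right

theorem tsum_measure_inter_fiber {X : Type*} [MeasurableSpace X] (μ : Measure X) {S : Set X}
    (hS : MeasurableSet S) {idx : X → ℕ} (hidx : Measurable idx) :
    ∑' z, μ (S ∩ idx ⁻¹' {z}) = μ S := by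
  rw [← measure_iUnion]
  · congr 1
    ext x
    simp
  · intro i j hij
    exact ((disjoint_singleton.2 hij).preimage idx).mono inter_subset_right inter_subset_right
  · exact fun z => hS.inter (hidx (measurableSet_singleton z))

/-! ### Discs in the plane -/

theorem meanCount_ball (lam : ℝ) (x : Space 2) (r : ℝ) :
    meanCount lam (Metric.ball x r) = (lam * (Real.pi * (max r 0) ^ 2)).toNNReal := by
  rw [meanCount, EuclideanSpace.volume_ball_fin_two, ENNReal.toReal_mul, ENNReal.toReal_pow,
    ENNReal.toReal_ofReal', ENNReal.toReal_ofReal Real.pi_pos.le, mul_comm Real.pi]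

theorem continuous_poissonMeasure_singleton (n : ℕ) :
    Continuous fun r : NNReal => poissonMeasure r {n} := by
  simp_rw [poissonMeasure_singleton]
  exact ENNReal.continuous_ofReal.comp (by fun_prop)

theorem continuous_poissonMeasure_ball (lam : ℝ) (n : ℕ) : Continuous fun r : ℝ =>
    poissonMeasure (meanCount lam (Metric.ball (0 : Space 2) r)) {n} := by
  simp_rw [meanCount_ball]
  exact (continuous_poissonMeasure_singleton n).comp (by fun_prop)

/-! ### Almost sure properties of Poisson processes -/

section AlmostSure

variable {Ω : Type*} [mΩ : MeasurableSpace Ω] {P : Measure Ω} {lam : ℝ} {d : ℕ}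

theorem IsHomogeneousPoisson.measure_count_ne_zero_le {Φ : Ω → Set (Space d)}
    (h : IsHomogeneousPoisson P lam Φ) (hlam : 0 ≤ lam) {A : Set (Space d)}
    (hA : MeasurableSet A) (hv : volume A ≠ ⊤) :
    P {ω | pointCount Φ A ω ≠ 0} ≤ ENNReal.ofReal lam * volume A := by
  rw [← h.lintegral_count hlam hA hv]
  have := mul_meas_ge_le_lintegral (μ := P)
    (measurable_enat_toENNReal.comp (h.measurable_count A hA)) 1
  rw [one_mul] at this
  refine (measure_mono fun ω hω => ?_).trans this
  have h1 : (1 : ℕ∞) ≤ pointCount Φ A ω := Order.one_le_iff_pos.2 (pos_iff_ne_zero.2 hω)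
  simpa using ENat.toENNReal_mono h1

theorem IsHomogeneousPoisson.ae_notMem {Φ : Ω → Set (Space d)} [NeZero d]
    (h : IsHomogeneousPoisson P lam Φ) (hlam : 0 ≤ lam) (x : Space d) : ∀ᵐ ω ∂P, x ∉ Φ ω := by
  have := h.measure_count_ne_zero_le hlam (measurableSet_singleton x) (by simp)
  rw [measure_singleton, mul_zero, nonpos_iff_eq_zero] at this
  filter_upwards [measure_eq_zero_iff_ae_notMem.1 this] with ω hω hx
  apply hω
  simp [pointCount, hx]

theorem IsHomogeneousPoisson.ae_finite_inter {Φ : Ω → Set (Space d)}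
    (h : IsHomogeneousPoisson P lam Φ) {B : Set (Space d)}
    (hB : MeasurableSet B) (hv : volume B ≠ ⊤) : ∀ᵐ ω ∂P, (Φ ω ∩ B).Finite := by
  filter_upwards [measure_eq_zero_iff_ae_notMem.1 (h.measure_count_eq_top hB hv)] with ω hω
  exact encard_ne_top_iff.1 hω

theorem IsHomogeneousPoisson.ae_locallyFinite {Φ : Ω → Set (Space d)}
    (h : IsHomogeneousPoisson P lam Φ) :
    ∀ᵐ ω ∂P, ∀ (x : Space d) (r : ℝ), (Φ ω ∩ Metric.ball x r).Finite := by
  have : ∀ᵐ ω ∂P, ∀ n : ℕ, (Φ ω ∩ Metric.ball 0 n).Finite := ae_all_iff.2 fun n =>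
    h.ae_finite_inter Metric.isOpen_ball.measurableSet measure_ball_lt_top.ne
  filter_upwards [this] with ω hω x r
  obtain ⟨n, hn⟩ := exists_nat_ge (r + dist x 0)
  exact (hω n).subset (inter_subset_inter_right _ (Metric.ball_subset_ball' hn))

/-- The void probabilities `exp (-lam π n²)` of growing discs tend to zero. -/
theorem IsHomogeneousPoisson.ae_nonempty {Φ : Ω → Set (Space 2)}
    (h : IsHomogeneousPoisson P lam Φ) (hlam : 0 < lam) : ∀ᵐ ω ∂P, (Φ ω).Nonempty := by
  have hle : ∀ n : ℕ, P {ω | ¬ (Φ ω).Nonempty} ≤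
      ENNReal.ofReal (Real.exp (-(lam * (Real.pi * (n : ℝ) ^ 2)))) := by
    intro n
    have h0 := h.measure_count_eq (A := Metric.ball 0 n) Metric.isOpen_ball.measurableSet
      measure_ball_lt_top.ne 0
    rw [poissonMeasure_singleton, meanCount_ball, max_eq_left (by positivity),
      Real.coe_toNNReal _ (by have := Real.pi_pos; positivity)] at h0
    simp only [pow_zero, mul_one, Nat.factorial_zero, Nat.cast_one, div_one] at h0
    rw [← h0]
    refine measure_mono fun ω hω => ?_
    have : Φ ω = ∅ := not_nonempty_iff_eq_empty.1 hω
    simp [pointCount, this]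
  have hlim : Tendsto (fun n : ℕ => ENNReal.ofReal (Real.exp (-(lam * (Real.pi * (n : ℝ) ^ 2)))))
      atTop (𝓝 0) := by
    rw [← ENNReal.ofReal_zero]
    refine ENNReal.tendsto_ofReal (Real.tendsto_exp_neg_atTop_nhds_zero.comp ?_)
    exact (((tendsto_pow_atTop two_ne_zero).comp tendsto_natCast_atTop_atTop).const_mul_atTop
      Real.pi_pos).const_mul_atTop hlam
  exact nonpos_iff_eq_zero.1 (ge_of_tendsto' hlim hle)

/-- Independent Poisson processes have no point in common. -/
theorem IsPoissonModel.ae_disjoint {lamL lamE : ℝ} {nodes eaves : Ω → Set (Space 2)}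
    (h : IsPoissonModel P lamL lamE nodes eaves) (hL : 0 ≤ lamL) (hE : 0 ≤ lamE) :
    ∀ᵐ ω ∂P, Disjoint (nodes ω) (eaves ω) := by
  have key : ∀ B : Set (Space 2), MeasurableSet B → volume B ≠ ⊤ →
      P {ω | (nodes ω ∩ eaves ω ∩ B).Nonempty} = 0 := by
    intro B hB hv
    -- A common point forces both processes to hit one cell. By independence a cell `C` contributes
    -- at most `lamL |C| · lamE π δ²`, and the sum over the cells is of order `δ²`.
    have hle : ∀ m : ℕ, P {ω | (nodes ω ∩ eaves ω ∩ B).Nonempty} ≤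
        ENNReal.ofReal lamL * volume B * (ENNReal.ofReal lamE *
          (ENNReal.ofReal (1 / ((m : ℝ) + 1)) ^ 2 * ENNReal.ofReal Real.pi)) := by
      intro m
      obtain ⟨idx, c, hidx, hc⟩ := exists_measurable_cellIndex (X := Space 2)
        (δ := 1 / ((m : ℝ) + 1)) (by positivity)
      have hcell : ∀ z, MeasurableSet (B ∩ idx ⁻¹' {z}) := fun z =>
        hB.inter (hidx (measurableSet_singleton z))
      have hvol : ∀ z, volume (B ∩ idx ⁻¹' {z}) ≠ ⊤ := fun z =>
        measure_ne_top_of_subset inter_subset_left hv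
      calc P {ω | (nodes ω ∩ eaves ω ∩ B).Nonempty}
          ≤ P (⋃ z, {ω | pointCount nodes (B ∩ idx ⁻¹' {z}) ω ≠ 0} ∩
              {ω | pointCount eaves (B ∩ idx ⁻¹' {z}) ω ≠ 0}) := by
            refine measure_mono ?_
            rintro ω ⟨x, ⟨hx1, hx2⟩, hx3⟩
            refine mem_iUnion.2 ⟨idx x, ?_, ?_⟩ <;>
            · simp only [pointCount, ne_eq, encard_eq_zero]
              exact Nonempty.ne_empty ⟨x, by assumption, hx3, rfl⟩
        _ ≤ ∑' z, P ({ω | pointCount nodes (B ∩ idx ⁻¹' {z}) ω ≠ 0} ∩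
              {ω | pointCount eaves (B ∩ idx ⁻¹' {z}) ω ≠ 0}) := measure_iUnion_le _
        _ ≤ ∑' z, ENNReal.ofReal lamL * volume (B ∩ idx ⁻¹' {z}) * (ENNReal.ofReal lamE *
          (ENNReal.ofReal (1 / ((m : ℝ) + 1)) ^ 2 * ENNReal.ofReal Real.pi)) := by
            refine ENNReal.tsum_le_tsum fun z => ?_
            refine ((Indep_iff _ _ P).1 h.indep _ _
              (measurable_pointCount_processSigma nodes (hcell z)
                (MeasurableSet.of_discrete (s := {0}ᶜ)))
              (measurable_pointCount_processSigma eaves (hcell z)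
                (MeasurableSet.of_discrete (s := {0}ᶜ)))).trans_le ?_
            refine mul_le_mul' (h.nodes_poisson.measure_count_ne_zero_le hL (hcell z) (hvol z))
              ((h.eaves_poisson.measure_count_ne_zero_le hE (hcell z) (hvol z)).trans ?_)
            rw [← EuclideanSpace.volume_ball_fin_two (c z)]
            gcongr
            rintro x ⟨_, rfl⟩
            exact hc x
        _ = _ := by
            rw [ENNReal.tsum_mul_right, ENNReal.tsum_mul_left, tsum_measure_inter_fiber _ hB hidx]
    have hlim : Tendsto (fun m : ℕ => ENNReal.ofReal lamL * volume B * (ENNReal.ofReal lamE *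
          (ENNReal.ofReal (1 / ((m : ℝ) + 1)) ^ 2 * ENNReal.ofReal Real.pi))) atTop (𝓝 0) := by
      have h0 : Tendsto (fun m : ℕ => ENNReal.ofReal (1 / ((m : ℝ) + 1))) atTop (𝓝 0) := by
        rw [← ENNReal.ofReal_zero]
        exact ENNReal.tendsto_ofReal tendsto_one_div_add_atTop_nhds_zero_nat
      have h1 := ENNReal.Tendsto.const_mul (a := ENNReal.ofReal lamL * volume B)
        (ENNReal.Tendsto.const_mul (a := ENNReal.ofReal lamE)
          (ENNReal.Tendsto.mul_const (b := ENNReal.ofReal Real.pi) (ENNReal.Tendsto.pow (n := 2) h0)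
            (Or.inr ENNReal.ofReal_ne_top)) (Or.inr ENNReal.ofReal_ne_top))
        (Or.inr (ENNReal.mul_ne_top ENNReal.ofReal_ne_top hv))
      simpa using h1
    exact nonpos_iff_eq_zero.1 (ge_of_tendsto' hlim hle)
  have hall : ∀ᵐ ω ∂P, ∀ n : ℕ, ¬ (nodes ω ∩ eaves ω ∩ Metric.ball 0 n).Nonempty :=
    ae_all_iff.2 fun n => measure_eq_zero_iff_ae_notMem.1
      (key _ Metric.isOpen_ball.measurableSet measure_ball_lt_top.ne)
  filter_upwards [hall] with ω hω
  rw [disjoint_left]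
  intro x hx hx'
  obtain ⟨n, hn⟩ := exists_nat_gt (dist x 0)
  exact hω n ⟨x, ⟨hx, hx'⟩, hn⟩

end AlmostSure

/-! ### The distance to the nearest point -/

section NearestPoint

/-- The distance to the empty set is `0` by convention, hence the nonemptiness clause for positive
`a`. -/
theorem le_infDist_iff_of_pos {X : Type*} [PseudoMetricSpace X] {S : Set X} {q : X} {a : ℝ}
    (ha : 0 < a) :
    a ≤ Metric.infDist q S ↔ S ≠ ∅ ∧ S ∩ Metric.ball q a = ∅ := by
  rcases S.eq_empty_or_nonempty with rfl | hS
  · simp [ha]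
  · rw [Metric.le_infDist hS, and_iff_right hS.ne_empty, ← disjoint_iff_inter_eq_empty,
      disjoint_left]
    simp only [Metric.mem_ball, not_lt, dist_comm q]

theorem measurable_infDist_processSigma {Ω : Type*} {d : ℕ} (Φ : Ω → Set (Space d))
    (q : Space d) : Measurable[processSigma Φ] fun ω => Metric.infDist q (Φ ω) := by
  let _ : MeasurableSpace Ω := processSigma Φ
  refine measurable_of_Ici fun a => ?_
  rcases le_or_gt a 0 with ha | ha
  · convert! @MeasurableSet.univ _ (processSigma Φ)
    exact eq_univ_of_forall fun ω => ha.trans Metric.infDist_nonneg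
  · have h1 := measurable_pointCount_processSigma Φ MeasurableSet.univ
      (MeasurableSet.of_discrete (s := {0}ᶜ))
    have h2 := measurable_pointCount_processSigma Φ
      (Metric.isOpen_ball (x := q) (ε := a)).measurableSet (MeasurableSet.of_discrete (s := {0}))
    convert! @MeasurableSet.inter _ (processSigma Φ) _ _ h1 h2 using 1
    ext ω
    simp [pointCount, le_infDist_iff_of_pos ha]

variable {Ω : Type*} [mΩ : MeasurableSpace Ω] {P : Measure Ω} {lam : ℝ} {Φ : Ω → Set (Space 2)}

theorem IsHomogeneousPoisson.measurable_infDist {d : ℕ} {Φ : Ω → Set (Space d)}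
    (h : IsHomogeneousPoisson P lam Φ) (q : Space d) :
    Measurable fun ω => Metric.infDist q (Φ ω) :=
  (measurable_infDist_processSigma Φ q).mono h.processSigma_le le_rfl

/-- The area of the disc that reaches to the nearest point of a planar Poisson process is
exponentially distributed. -/
theorem IsHomogeneousPoisson.map_area_eq_expMeasure [IsProbabilityMeasure P]
    (h : IsHomogeneousPoisson P lam Φ) (hlam : 0 < lam) (q : Space 2) :
    P.map (fun ω => Real.pi * Metric.infDist q (Φ ω) ^ 2) = expMeasure lam := by
  have hmeas : Measurable fun ω => Real.pi * Metric.infDist q (Φ ω) ^ 2 :=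
    ((h.measurable_infDist q).pow_const 2).const_mul _
  have := Measure.isProbabilityMeasure_map (μ := P) hmeas.aemeasurable
  have := isProbabilityMeasure_expMeasure hlam
  -- Absence of atoms allows the closed half-line `Ici a` to replace `Ioi a`.
  have : NullSingletonClass (expMeasure lam) := by
    rw [expMeasure, gammaMeasure]
    unfold gammaPDF
    infer_instance
  refine Measure.ext_of_Ici _ _ fun a => ?_
  have hexp : expMeasure lam (Ici a) =
      ENNReal.ofReal (if 0 ≤ a then Real.exp (-(lam * a)) else 1) := by
    rw [← Ioi_ae_eq_Ici.measure_eq, ← compl_Iic, prob_compl_eq_one_sub measurableSet_Iic,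
      ← ofReal_cdf, cdf_expMeasure_eq hlam, ← ENNReal.ofReal_one,
      ← ENNReal.ofReal_sub _ (by
        split_ifs with ha
        · rw [sub_nonneg, Real.exp_le_one_iff, neg_nonpos]
          positivity
        · rfl)]
    congr 1
    split_ifs <;> ring
  rw [hexp, Measure.map_apply hmeas measurableSet_Ici]
  rcases le_or_gt a 0 with ha | ha
  · rw [show (fun ω => Real.pi * Metric.infDist q (Φ ω) ^ 2) ⁻¹' Ici a = univ from
      eq_univ_of_forall fun ω => ha.trans (by have := Real.pi_pos; positivity), measure_univ]
    split_ifs with h0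
    · simp [le_antisymm ha h0]
    · simp
  -- `r` is the radius of the disc of area `a`; the event is, up to a null set, that this disc is
  -- void.
  · set r := √(a / Real.pi) with hr
    have hpi := Real.pi_pos
    have hrpos : 0 < r := Real.sqrt_pos.2 (by positivity)
    have hr2 : Real.pi * r ^ 2 = a := by
      rw [hr, Real.sq_sqrt (by positivity)]
      field_simp
    have hset : (fun ω => Real.pi * Metric.infDist q (Φ ω) ^ 2) ⁻¹' Ici a =ᵐ[P]
        {ω | pointCount Φ (Metric.ball q r) ω = (0 : ℕ)} := by
      filter_upwards [h.ae_nonempty hlam] with ω hω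
      apply propext
      change a ≤ Real.pi * Metric.infDist q (Φ ω) ^ 2 ↔ pointCount Φ (Metric.ball q r) ω = (0 : ℕ)
      rw [← hr2, mul_le_mul_iff_right₀ hpi, sq_le_sq₀ hrpos.le Metric.infDist_nonneg,
        le_infDist_iff_of_pos hrpos, and_iff_right hω.ne_empty]
      simp [pointCount]
    rw [measure_congr hset, h.measure_count_eq Metric.isOpen_ball.measurableSet
      measure_ball_lt_top.ne, poissonMeasure_singleton, meanCount_ball, max_eq_left hrpos.le, hr2,
      Real.coe_toNNReal _ (by positivity)]
    simp [ha.le]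

/-- The distance is a function of the area, whose law does not involve the centre; no translation
invariance of the process is invoked. -/
theorem IsHomogeneousPoisson.map_infDist_eq [IsProbabilityMeasure P]
    (h : IsHomogeneousPoisson P lam Φ) (hlam : 0 < lam) (q q' : Space 2) :
    P.map (fun ω => Metric.infDist q (Φ ω)) = P.map (fun ω => Metric.infDist q' (Φ ω)) := by
  have hrec : ∀ q : Space 2, P.map (fun ω => Metric.infDist q (Φ ω)) =
      (expMeasure lam).map fun v => √(v / Real.pi) := by
    intro q
    rw [← h.map_area_eq_expMeasure hlam q, Measure.map_map (by fun_prop)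
      (((h.measurable_infDist q).pow_const 2).const_mul _)]
    congr 1
    ext ω
    have := Real.pi_pos
    simp only [Function.comp_apply]
    rw [mul_div_cancel_left₀ _ this.ne', Real.sqrt_sq Metric.infDist_nonneg]
  rw [hrec, hrec]

/-! ### A Poisson number of points in an exponential area -/

/-- The exponential density times the Poisson weight is the claimed constant times the Gamma density
of shape `n + 1` and rate `lamL + lamE`. -/
theorem lintegral_poissonMeasure_expMeasure {lamL lamE : ℝ} (hL : 0 < lamL) (hE : 0 < lamE)
    (n : ℕ) :
    ∫⁻ v, poissonMeasure (lamL * v).toNNReal {n} ∂expMeasure lamE =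
      ENNReal.ofReal ((lamL / (lamL + lamE)) ^ n * (lamE / (lamL + lamE))) := by
  have hpdf : ∀ v, gammaPDF 1 lamE v * poissonMeasure (lamL * v).toNNReal {n} =
      ENNReal.ofReal ((lamL / (lamL + lamE)) ^ n * (lamE / (lamL + lamE))) *
        gammaPDF (n + 1) (lamL + lamE) v := by
    intro v
    rcases lt_or_ge v 0 with hv | hv
    · rw [gammaPDF_of_neg hv, gammaPDF_of_neg hv, zero_mul, mul_zero]
    · rw [gammaPDF_of_nonneg hv, gammaPDF_of_nonneg hv, poissonMeasure_singleton,
        Real.coe_toNNReal _ (by positivity), ← ENNReal.ofReal_mul (by positivity),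
        ← ENNReal.ofReal_mul (by positivity)]
      congr 1
      rw [Real.Gamma_one, Real.Gamma_nat_eq_factorial, sub_self, Real.rpow_zero, Real.rpow_one,
        add_sub_cancel_right, Real.rpow_natCast,
        show ((n : ℝ) + 1) = ((n + 1 : ℕ) : ℝ) by push_cast; ring, Real.rpow_natCast,
        show -((lamL + lamE) * v) = -(lamL * v) + -(lamE * v) by ring, Real.exp_add]
      have : lamL + lamE ≠ 0 := by positivity
      rw [div_pow]
      field_simp
      ring
  have hm : Measurable fun v : ℝ => poissonMeasure (lamL * v).toNNReal {n} :=
    ((continuous_poissonMeasure_singleton n).comp (by fun_prop)).measurable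
  rw [expMeasure, gammaMeasure,
    lintegral_withDensity_eq_lintegral_mul _
      (show Measurable (gammaPDF 1 lamE) from (measurable_gammaPDFReal 1 lamE).ennreal_ofReal) hm]
  simp only [Pi.mul_apply]
  rw [lintegral_congr hpdf, lintegral_const_mul _ (show Measurable (gammaPDF (n + 1) (lamL + lamE)) from
      (measurable_gammaPDFReal _ _).ennreal_ofReal),
    lintegral_gammaPDF_eq_one (by positivity) (by positivity), mul_one]

theorem IsHomogeneousPoisson.lintegral_poissonMeasure_ball_infDist [IsProbabilityMeasure P]
    {lamL : ℝ} (h : IsHomogeneousPoisson P lam Φ) (hL : 0 < lamL) (hlam : 0 < lam) (q : Space 2)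
    (n : ℕ) :
    ∫⁻ ω, poissonMeasure (meanCount lamL (Metric.ball (0 : Space 2)
        (Metric.infDist q (Φ ω)))) {n} ∂P =
      ENNReal.ofReal ((lamL / (lamL + lam)) ^ n * (lam / (lamL + lam))) := by
  have hm : Measurable fun v : ℝ => poissonMeasure (lamL * v).toNNReal {n} :=
    ((continuous_poissonMeasure_singleton n).comp (by fun_prop)).measurable
  rw [← lintegral_poissonMeasure_expMeasure hL hlam, ← h.map_area_eq_expMeasure hlam q,
    lintegral_map hm (((h.measurable_infDist q).pow_const 2).const_mul _)]
  refine lintegral_congr fun ω => ?_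
  rw [meanCount_ball, max_eq_left Metric.infDist_nonneg]

end NearestPoint

/-! ### The out-degree in the basic graph -/

/-- `g r > g (r + 1)`, and the latter is at least the limit `0`. Positivity keeps the arguments of
the logarithms positive. -/
theorem IsPathLossGain.pos {g : ℝ → ℝ} (hg : IsPathLossGain g) {r : ℝ} (hr : 0 < r) : 0 < g r := by
  have h1 : g (r + 1) < g r :=
    hg.strictAntiOn (mem_Ioi.2 hr) (mem_Ioi.2 (by linarith)) (by linarith)
  refine lt_of_le_of_lt (le_of_tendsto hg.tendsto_zero ?_) h1
  filter_upwards [eventually_ge_atTop (r + 1)] with s hs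
  exact hg.strictAntiOn.antitoneOn (mem_Ioi.2 (by linarith)) (mem_Ioi.2 (by linarith)) hs

theorem isClosed_of_forall_finite_inter_ball {X : Type*} [PseudoMetricSpace X] [T1Space X]
    {E : Set X} (hE : ∀ x r, (E ∩ Metric.ball x r).Finite) : IsClosed E := by
  refine isClosed_of_closure_subset fun x hx => ?_
  have hx' : x ∈ closure (E ∩ Metric.ball x 1) :=
    mem_closure_iff_nhds'.2 fun t ht => by
      obtain ⟨⟨y, hy⟩, hyt⟩ := mem_closure_iff_nhds'.1 hx (t ∩ Metric.ball x 1)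
        (inter_mem ht (Metric.ball_mem_nhds x one_pos))
      exact ⟨⟨y, hy, hyt.2⟩, hyt.1⟩
  rw [(hE x 1).isClosed.closure_eq] at hx'
  exact hx'.1

/-- The number of points of `S`, other than `x`, that are nearer to `x` than all of `E`. -/
noncomputable def secureDegree {X : Type*} [PseudoMetricSpace X] (S E : Set X) (x : X) : ℕ∞ :=
  ((S ∩ Metric.ball x (Metric.infDist x E)) \ {x}).encard

section Graph

variable {d : ℕ} {power noise : ℝ} {g : ℝ → ℝ} {S E : Set (Space d)}

/-- A locally finite set is closed, so a nearest eavesdropper exists; as the gain decreases, it is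
the strongest one. -/
theorem exists_strongestPower_eq (hpower : 0 < power) (hg : IsPathLossGain g)
    (hEne : E.Nonempty) (hE : ∀ x r, (E ∩ Metric.ball x r).Finite) {x : Space d} (hx : x ∉ E) :
    0 < Metric.infDist x E ∧
      strongestPower (pathLossPower power g) E x = power * g (Metric.infDist x E) := by
  have hcl := isClosed_of_forall_finite_inter_ball hE
  obtain ⟨e, he, hd⟩ := hcl.exists_infDist_eq_dist hEne x
  have hpos : 0 < Metric.infDist x E := (hcl.notMem_iff_infDist_pos hEne).1 hx
  refine ⟨hpos, ?_⟩
  rw [strongestPower_eq _ _ _ e he, pathLossPower, hd]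
  intro e' he'
  have hle : dist x e ≤ dist x e' := hd ▸ Metric.infDist_le_dist_of_mem he'
  have h0 : 0 < dist x e := hd ▸ hpos
  exact mul_le_mul_of_nonneg_left (hg.strictAntiOn.antitoneOn h0 (h0.trans_le hle) hle) hpower.le

theorem maxSecrecyRate_pos_iff (hpower : 0 < power) (hnoise : 0 < noise) (hg : IsPathLossGain g)
    (hEne : E.Nonempty) (hE : ∀ x r, (E ∩ Metric.ball x r).Finite) {x y : Space d} (hx : x ∉ E)
    (hxy : x ≠ y) :
    0 < maxSecrecyRate (pathLossPower power g) noise noise E x y ↔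
      dist x y < Metric.infDist x E := by
  obtain ⟨hpos, hs⟩ := exists_strongestPower_eq hpower hg hEne hE hx
  have hd : 0 < dist x y := dist_pos.2 hxy
  have hgy := hg.pos hd
  have hge := hg.pos hpos
  rw [maxSecrecyRate, lt_max_iff, or_iff_left (lt_irrefl 0), sub_pos, hs, pathLossPower,
    Real.logb_lt_logb_iff one_lt_two (by positivity) (by positivity), add_lt_add_iff_left,
    div_lt_div_iff_of_pos_right hnoise, mul_lt_mul_iff_right₀ hpower,
    hg.strictAntiOn.lt_iff_gt hpos hd]

theorem outDegree_basicISGraph (hpower : 0 < power) (hnoise : 0 < noise) (hg : IsPathLossGain g)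
    (hEne : E.Nonempty) (hE : ∀ x r, (E ∩ Metric.ball x r).Finite) (x : S) (hx : (x : Space d) ∉ E) :
    outDegree (basicISGraph power noise g S E) x = secureDegree S E x := by
  rw [outDegree, secureDegree, ← Subtype.val_injective.encard_image]
  congr 1
  ext y
  simp only [mem_image, mem_ofPred_eq, Subtype.exists, exists_and_right, exists_eq_right,
    basicISGraph, isGraph]
  constructor
  · rintro ⟨⟨hy, hne⟩, hlt⟩
    have hne' : (x : Space d) ≠ y := fun h => hne (Subtype.ext h)
    refine ⟨⟨hy, ?_⟩, hne'.symm⟩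
    rw [Metric.mem_ball']
    exact (maxSecrecyRate_pos_iff hpower hnoise hg hEne hE hx hne').1 hlt
  · rintro ⟨⟨hy, hlt⟩, hne⟩
    have hne' : (x : Space d) ≠ y := Ne.symm hne
    rw [Metric.mem_ball'] at hlt
    refine ⟨⟨hy, fun h => hne' (congrArg Subtype.val h)⟩, ?_⟩
    exact (maxSecrecyRate_pos_iff hpower hnoise hg hEne hE hx hne').2 hlt

theorem secureDegree_insert {X : Type*} [PseudoMetricSpace X] (S E : Set X) (x : X) :
    secureDegree (insert x S) E x = secureDegree S E x := by
  rw [secureDegree, secureDegree]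
  congr 1
  ext y
  by_cases hy : y = x <;> simp [hy]

theorem secureDegree_ne_top {X : Type*} [PseudoMetricSpace X] {S : Set X}
    (hS : ∀ x r, (S ∩ Metric.ball x r).Finite) (E : Set X) (x : X) :
    secureDegree S E x ≠ ⊤ :=
  encard_ne_top_iff.2 ((hS x _).subset sdiff_subset)

theorem outIsolated_iff {V : Type*} (G : Digraph V) (v : V) :
    OutIsolated G v ↔ outDegree G v = 0 := by
  simp [OutIsolated, outDegree, eq_empty_iff_forall_notMem]

end Graph

/-! ### Discretised discs -/

/-- The radius of the disc of the `m`-th discretisation whose index is `k`. -/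
noncomputable def gridRadius (m k : ℕ) : ℝ := ((k : ℝ) - 2) / (m + 1)

/-- The index of the disc of the `m`-th discretisation for the distance `t`. -/
noncomputable def gridIndex (m : ℕ) (t : ℝ) : ℕ := ⌊t * (m + 1)⌋₊

theorem measurable_gridIndex (m : ℕ) : Measurable (gridIndex m) :=
  Nat.measurable_floor.comp (measurable_id.mul_const _)

theorem gridRadius_le {t : ℝ} (ht : 0 ≤ t) (m : ℕ) :
    gridRadius m (gridIndex m t) ≤ t - 2 * (1 / ((m : ℝ) + 1)) := by
  have h : (gridIndex m t : ℝ) ≤ t * (m + 1) := Nat.floor_le (by positivity)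
  rw [gridRadius, div_le_iff₀ (by positivity), sub_mul, mul_assoc,
    one_div_mul_cancel (by positivity)]
  linarith

theorem lt_gridRadius (t : ℝ) (m : ℕ) :
    t - 3 * (1 / ((m : ℝ) + 1)) < gridRadius m (gridIndex m t) := by
  have h : t * (m + 1) < (gridIndex m t : ℝ) + 1 := Nat.lt_floor_add_one _
  rw [gridRadius, lt_div_iff₀ (by positivity), sub_mul, mul_assoc,
    one_div_mul_cancel (by positivity)]
  linarith

theorem tendsto_gridRadius {t : ℝ} (ht : 0 ≤ t) :
    Tendsto (fun m => gridRadius m (gridIndex m t)) atTop (𝓝 t) := by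
  have h := tendsto_one_div_add_atTop_nhds_zero_nat (𝕜 := ℝ)
  refine tendsto_of_tendsto_of_tendsto_of_le_of_le (g := fun m : ℕ => t - 3 * (1 / ((m : ℝ) + 1)))
    (h := fun m : ℕ => t - 2 * (1 / ((m : ℝ) + 1))) ?_ ?_ (fun m => (lt_gridRadius t m).le)
    (fun m => gridRadius_le ht m)
  · simpa using (h.const_mul 3).const_sub t
  · simpa using (h.const_mul 2).const_sub t

/-- The shift by `2` in `gridRadius` pays for replacing `x` by `q` twice, as centre and as base of
the distance, so the approximate disc lies inside the true one. Conversely, the finitely many points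
of the open true disc have positive slack, which exceeds the error for large `m`. -/
theorem eventually_inter_ball_gridRadius_eq {X : Type*} [PseudoMetricSpace X] {S E : Set X} {x : X}
    (hS : (S ∩ Metric.ball x (Metric.infDist x E)).Finite) :
    ∀ᶠ m : ℕ in atTop, ∀ q, dist x q < 1 / ((m : ℝ) + 1) →
      S ∩ Metric.ball q (gridRadius m (gridIndex m (Metric.infDist q E))) =
        S ∩ Metric.ball x (Metric.infDist x E) := by
  -- The factor `5` is `3` for the loss in `lt_gridRadius` plus `2` for moving between `x` and `q`.
  have hev : ∀ y ∈ S ∩ Metric.ball x (Metric.infDist x E), ∀ᶠ m : ℕ in atTop,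
      5 * (1 / ((m : ℝ) + 1)) < Metric.infDist x E - dist y x := by
    rintro y ⟨_, hy⟩
    have h := (tendsto_one_div_add_atTop_nhds_zero_nat (𝕜 := ℝ)).const_mul 5
    rw [mul_zero] at h
    exact h.eventually_lt_const (sub_pos.2 hy)
  filter_upwards [(eventually_all_finite hS).2 hev] with m hm q hq
  refine Subset.antisymm ?_ ?_
  · rintro y ⟨hy, hyb⟩
    refine ⟨hy, ?_⟩
    rw [Metric.mem_ball] at hyb ⊢
    have h1 := gridRadius_le (Metric.infDist_nonneg (x := q) (s := E)) m
    have h2 := Metric.infDist_le_infDist_add_dist (x := q) (y := x) (s := E)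
    have h3 := dist_triangle y q x
    rw [dist_comm q x] at h2 h3
    linarith
  · rintro y hy
    refine ⟨hy.1, ?_⟩
    have h0 := hm y hy
    rw [Metric.mem_ball]
    have h1 := lt_gridRadius (Metric.infDist q E) m
    have h2 := Metric.infDist_le_infDist_add_dist (x := x) (y := q) (s := E)
    have h3 := dist_triangle y x q
    linarith

theorem measurable_comp_nat {Ω β : Type*} [MeasurableSpace Ω] [MeasurableSpace β] {G : ℕ → Ω → β}
    (hG : ∀ k, Measurable (G k)) {K : Ω → ℕ} (hK : Measurable K) :
    Measurable fun ω => G (K ω) ω := by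
  have h : Measurable fun p : Ω × ℕ => G p.2 p.1 := measurable_from_prod_countable_left hG
  exact h.comp (measurable_id.prodMk hK)

/-- The points of `S` in `B` with out-degree `n`. -/
def pointsOfDegree {X : Type*} [PseudoMetricSpace X] (S E B : Set X) (n : ℕ) : Set X :=
  {x | x ∈ S ∩ B ∧ secureDegree S E x = n}

/-! ### Removing the discretisation -/

section Limits

variable {Ω : Type*} [MeasurableSpace Ω] {P : Measure Ω} [IsProbabilityMeasure P] {lamL lamE : ℝ}
  {nodes eaves : Ω → Set (Space 2)}

theorem IsHomogeneousPoisson.tendsto_lintegral_gridRadius (h : IsHomogeneousPoisson P lamE eaves)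
    (hL : 0 < lamL) (hE : 0 < lamE) (n : ℕ) :
    Tendsto (fun m => ∫⁻ ω, poissonMeasure (meanCount lamL (Metric.ball (0 : Space 2)
        (gridRadius m (gridIndex m (Metric.infDist 0 (eaves ω)))))) {n} ∂P) atTop
      (𝓝 (ENNReal.ofReal ((lamL / (lamL + lamE)) ^ n * (lamE / (lamL + lamE))))) := by
  rw [← h.lintegral_poissonMeasure_ball_infDist hL hE 0 n]
  refine tendsto_lintegral_of_dominated_convergence (fun _ => 1) (fun m => ?_)
    (fun m => ae_of_all _ fun ω => prob_le_one) (by simp) (ae_of_all _ fun ω => ?_)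
  · exact (measurable_of_countable (fun k : ℕ => poissonMeasure (meanCount lamL
      (Metric.ball (0 : Space 2) (gridRadius m k))) {n})).comp
        ((measurable_gridIndex m).comp (h.measurable_infDist 0))
  · exact (continuous_poissonMeasure_ball lamL n).continuousAt.tendsto.comp
      (tendsto_gridRadius Metric.infDist_nonneg)

/-- Freezing the radius by independence reduces this to the Mecke formula for a fixed disc.
Recentring at the origin gives all cells the same factor, so their volumes can be summed. -/
theorem IsPoissonModel.lintegral_encard_pointsSeeing_grid
    (h : IsPoissonModel P lamL lamE nodes eaves) (hL : 0 < lamL) (hE : 0 < lamE)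
    {C : Set (Space 2)} (hC : MeasurableSet C) (hvC : volume C ≠ ⊤) (q : Space 2) (m n : ℕ) :
    ∫⁻ ω, ((pointsSeeing (nodes ω) C (Metric.ball q
        (gridRadius m (gridIndex m (Metric.infDist q (eaves ω))))) n).encard : ℝ≥0∞) ∂P =
      volume C * (ENNReal.ofReal lamL * ∫⁻ ω, poissonMeasure (meanCount lamL
        (Metric.ball (0 : Space 2) (gridRadius m (gridIndex m (Metric.infDist 0 (eaves ω))))))
          {n} ∂P) := by
  have h1 := lintegral_comp_of_indep h.nodes_poisson.processSigma_le
    h.eaves_poisson.processSigma_le h.indep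
    (G := fun k ω => ((pointsSeeing (nodes ω) C (Metric.ball q (gridRadius m k)) n).encard : ℝ≥0∞))
    (fun k => measurable_encard_pointsSeeing_processSigma nodes hC
      Metric.isOpen_ball.measurableSet n)
    ((measurable_gridIndex m).comp (measurable_infDist_processSigma eaves q))
  refine h1.trans ?_
  have h2 : ∀ k, ∫⁻ ω, ((pointsSeeing (nodes ω) C
      (Metric.ball q (gridRadius m k)) n).encard : ℝ≥0∞) ∂P =
      ENNReal.ofReal lamL * volume C * poissonMeasure (meanCount lamL
        (Metric.ball (0 : Space 2) (gridRadius m k))) {n} := by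
    intro k
    rw [h.nodes_poisson.lintegral_encard_pointsSeeing hL.le hC
      Metric.isOpen_ball.measurableSet hvC measure_ball_lt_top.ne, meanCount_ball, meanCount_ball]
  have hm : Measurable fun t : ℝ => poissonMeasure (meanCount lamL
      (Metric.ball (0 : Space 2) (gridRadius m (gridIndex m t)))) {n} :=
    (measurable_of_countable (fun k : ℕ => poissonMeasure (meanCount lamL
      (Metric.ball (0 : Space 2) (gridRadius m k))) {n})).comp (measurable_gridIndex m)
  have hd := h.eaves_poisson.measurable_infDist
  simp_rw [h2, Function.comp_apply]
  rw [lintegral_const_mul (ENNReal.ofReal lamL * volume C)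
    (f := fun ω => poissonMeasure (meanCount lamL (Metric.ball (0 : Space 2)
      (gridRadius m (gridIndex m (Metric.infDist q (eaves ω)))))) {n}) (hm.comp (hd q)),
    ← mul_assoc, mul_comm (volume C)]
  congr 1
  rw [← lintegral_map hm (hd 0), ← h.eaves_poisson.map_infDist_eq hE q 0, lintegral_map hm (hd q)]

/-- The Campbell measure of the points of out-degree `n`. -/
theorem IsPoissonModel.lintegral_encard_pointsOfDegree
    (h : IsPoissonModel P lamL lamE nodes eaves) (hL : 0 < lamL) (hE : 0 < lamE)
    {B : Set (Space 2)} (hB : MeasurableSet B) (hv : volume B ≠ ⊤) (n : ℕ) :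
    AEMeasurable (fun ω => ((pointsOfDegree (nodes ω) (eaves ω) B n).encard : ℝ≥0∞)) P ∧
    ∫⁻ ω, ((pointsOfDegree (nodes ω) (eaves ω) B n).encard : ℝ≥0∞) ∂P =
      ENNReal.ofReal lamL * volume B *
        ENNReal.ofReal ((lamL / (lamL + lamE)) ^ n * (lamE / (lamL + lamE))) := by
  choose idx c hidx hc using fun m : ℕ => exists_measurable_cellIndex (X := Space 2)
    (δ := 1 / ((m : ℝ) + 1)) (by positivity)
  -- `F m` counts the nodes in `B` of degree `n` when each node uses the disc of its cell; it is
  -- dominated by the number of nodes in `B`.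
  set F : ℕ → Ω → ℝ≥0∞ := fun m ω => ∑' z, ((pointsSeeing (nodes ω) (B ∩ idx m ⁻¹' {z})
    (Metric.ball (c m z) (gridRadius m (gridIndex m (Metric.infDist (c m z) (eaves ω)))))
      n).encard : ℝ≥0∞) with hF
  have hcell : ∀ m z, MeasurableSet (B ∩ idx m ⁻¹' {z}) := fun m z =>
    hB.inter (hidx m (measurableSet_singleton z))
  have hterm : ∀ m z, Measurable fun ω => ((pointsSeeing (nodes ω) (B ∩ idx m ⁻¹' {z})
      (Metric.ball (c m z) (gridRadius m (gridIndex m (Metric.infDist (c m z) (eaves ω)))))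
        n).encard : ℝ≥0∞) := by
    intro m z
    exact measurable_comp_nat (G := fun k ω => ((pointsSeeing (nodes ω) (B ∩ idx m ⁻¹' {z})
        (Metric.ball (c m z) (gridRadius m k)) n).encard : ℝ≥0∞))
      (fun k => (measurable_encard_pointsSeeing_processSigma nodes (hcell m z)
        Metric.isOpen_ball.measurableSet n).mono h.nodes_poisson.processSigma_le le_rfl)
      ((measurable_gridIndex m).comp (h.eaves_poisson.measurable_infDist (c m z)))
  have hFm : ∀ m, Measurable (F m) := fun m => Measurable.tsum (hterm m)
  have hbound : ∀ m ω, F m ω ≤ (pointCount nodes B ω : ℝ≥0∞) := by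
    intro m ω
    rw [pointCount, encard_eq_tsum_fiber _ (idx m)]
    refine ENNReal.tsum_le_tsum fun z => ENat.toENNReal_mono (encard_le_encard ?_)
    rintro x ⟨⟨hx, hxB, hz⟩, -⟩
    exact ⟨⟨hx, hxB⟩, hz⟩
  have hlim : ∀ᵐ ω ∂P, Tendsto (fun m => F m ω) atTop
      (𝓝 ((pointsOfDegree (nodes ω) (eaves ω) B n).encard : ℝ≥0∞)) := by
    filter_upwards [h.nodes_poisson.ae_locallyFinite, h.nodes_poisson.ae_finite_inter hB hv]
      with ω hω hfin
    refine tendsto_const_nhds.congr' ?_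
    -- Only finitely many nodes lie in `B`, so one `m` serves them all, and `F m` is eventually
    -- equal to its limit.
    filter_upwards [(eventually_all_finite hfin).2 fun x _ =>
      eventually_inter_ball_gridRadius_eq (S := nodes ω) (E := eaves ω) (x := x) (hω x _)]
      with m hm
    rw [encard_eq_tsum_fiber _ (idx m)]
    refine tsum_congr fun z => ?_
    congr 2
    ext x
    have key : x ∈ nodes ω ∩ B → idx m x = z → nodes ω ∩ Metric.ball (c m z)
        (gridRadius m (gridIndex m (Metric.infDist (c m z) (eaves ω)))) =
          nodes ω ∩ Metric.ball x (Metric.infDist x (eaves ω)) := by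
      rintro hx rfl
      exact hm x hx _ (hc m x)
    constructor
    · rintro ⟨⟨hx, hdeg⟩, hz⟩
      refine ⟨⟨hx.1, hx.2, hz⟩, ?_⟩
      rw [key hx hz]
      exact hdeg
    · rintro ⟨⟨hx, hxB, hz⟩, hdeg⟩
      rw [key ⟨hx, hxB⟩ hz] at hdeg
      exact ⟨⟨⟨hx, hxB⟩, hdeg⟩, hz⟩
  refine ⟨aemeasurable_of_tendsto_metrizable_ae' (fun m => (hFm m).aemeasurable) hlim, ?_⟩
  have hfinite : ∫⁻ ω, (pointCount nodes B ω : ℝ≥0∞) ∂P ≠ ⊤ := by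
    rw [h.nodes_poisson.lintegral_count hL.le hB hv]
    exact ENNReal.mul_ne_top ENNReal.ofReal_ne_top hv
  refine tendsto_nhds_unique (tendsto_lintegral_of_dominated_convergence _ hFm
    (fun m => ae_of_all _ (hbound m)) hfinite hlim) ?_
  have hint : ∀ m, ∫⁻ ω, F m ω ∂P = ENNReal.ofReal lamL * volume B *
      ∫⁻ ω, poissonMeasure (meanCount lamL (Metric.ball (0 : Space 2)
        (gridRadius m (gridIndex m (Metric.infDist 0 (eaves ω)))))) {n} ∂P := by
    intro m
    rw [lintegral_tsum fun z => (hterm m z).aemeasurable]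
    simp_rw [h.lintegral_encard_pointsSeeing_grid hL hE (hcell m _)
      (measure_ne_top_of_subset inter_subset_left hv)]
    rw [ENNReal.tsum_mul_right, tsum_measure_inter_fiber _ hB (hidx m)]
    ring
  simp_rw [hint]
  exact ENNReal.Tendsto.const_mul (h.eaves_poisson.tendsto_lintegral_gridRadius hL hE n)
    (Or.inr (ENNReal.mul_ne_top ENNReal.ofReal_ne_top hv))

/-- The law of the out-degree of the origin. -/
theorem IsPoissonModel.measure_secureDegree_zero_eq
    (h : IsPoissonModel P lamL lamE nodes eaves) (hL : 0 < lamL) (hE : 0 < lamE) :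
    AEMeasurable (fun ω => secureDegree (nodes ω) (eaves ω) 0) P ∧
    ∀ n : ℕ, P {ω | secureDegree (nodes ω) (eaves ω) 0 = n} =
      ENNReal.ofReal ((lamL / (lamL + lamE)) ^ n * (lamE / (lamL + lamE))) := by
  -- Deleting the origin changes no mean count and turns the degree into a plain point count, so no
  -- Mecke formula is needed.
  set A : ℕ → ℕ → Set (Space 2) := fun m k => Metric.ball 0 (gridRadius m k) \ {0} with hA
  set K : ℕ → Ω → ℕ := fun m ω => gridIndex m (Metric.infDist 0 (eaves ω)) with hK
  have hAm : ∀ m k, MeasurableSet (A m k) := fun m k =>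
    Metric.isOpen_ball.measurableSet.diff (measurableSet_singleton _)
  have hAmean : ∀ m k, meanCount lamL (A m k) =
      meanCount lamL (Metric.ball (0 : Space 2) (gridRadius m k)) := fun m k => by
    rw [meanCount, meanCount, hA, measure_sdiff_null (measure_singleton _)]
  have hAv : ∀ m k, volume (A m k) ≠ ⊤ := fun m k =>
    measure_ne_top_of_subset sdiff_subset measure_ball_lt_top.ne
  have hKm : ∀ m, Measurable (K m) := fun m =>
    (measurable_gridIndex m).comp (h.eaves_poisson.measurable_infDist 0)
  have hNm : ∀ m, Measurable fun ω => pointCount nodes (A m (K m ω)) ω := fun m =>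
    measurable_comp_nat (fun k => h.nodes_poisson.measurable_count _ (hAm m k)) (hKm m)
  have hlim : ∀ᵐ ω ∂P, ∀ᶠ m in atTop,
      secureDegree (nodes ω) (eaves ω) 0 = pointCount nodes (A m (K m ω)) ω := by
    filter_upwards [h.nodes_poisson.ae_locallyFinite] with ω hω
    filter_upwards [eventually_inter_ball_gridRadius_eq (S := nodes ω) (E := eaves ω) (hω 0 _)]
      with m hm
    rw [secureDegree, pointCount, hA, ← inter_sdiff_assoc, hm 0 (by rw [dist_self]; positivity)]
  have hae : AEMeasurable (fun ω => secureDegree (nodes ω) (eaves ω) 0) P := by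
    have := borelSpace_enat
    refine aemeasurable_of_tendsto_metrizable_ae' (fun m => (hNm m).aemeasurable) ?_
    filter_upwards [hlim] with ω hω
    exact tendsto_const_nhds.congr' hω
  refine ⟨hae, fun n => ?_⟩
  have hP : P {ω | secureDegree (nodes ω) (eaves ω) 0 = n} =
      ∫⁻ ω, atCount n (secureDegree (nodes ω) (eaves ω) 0) ∂P := by
    have hs : NullMeasurableSet {ω | secureDegree (nodes ω) (eaves ω) 0 = n} P :=
      hae.nullMeasurableSet_preimage (MeasurableSet.of_discrete (s := {(n : ℕ∞)}))
    rw [← lintegral_indicator_one₀ hs]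
    rfl
  rw [hP]
  refine tendsto_nhds_unique (tendsto_lintegral_of_dominated_convergence
    (F := fun m ω => atCount n (pointCount nodes (A m (K m ω)) ω)) (fun _ => 1)
    (fun m => (measurable_atCount n).comp (hNm m))
    (fun m => ae_of_all _ fun ω => indicator_le_self _ _ _) (by simp) ?_) ?_
  · filter_upwards [hlim] with ω hω
    refine tendsto_const_nhds.congr' ?_
    filter_upwards [hω] with m hm
    rw [hm]
  · have hint : ∀ m, ∫⁻ ω, atCount n (pointCount nodes (A m (K m ω)) ω) ∂P =
        ∫⁻ ω, poissonMeasure (meanCount lamL (Metric.ball (0 : Space 2)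
          (gridRadius m (gridIndex m (Metric.infDist 0 (eaves ω)))))) {n} ∂P := by
      intro m
      refine (lintegral_comp_of_indep h.nodes_poisson.processSigma_le
        h.eaves_poisson.processSigma_le h.indep
        (G := fun k ω => atCount n (pointCount nodes (A m k) ω))
        (fun k => (measurable_atCount n).comp
          (measurable_pointCount_processSigma nodes (hAm m k)))
        ((measurable_gridIndex m).comp (measurable_infDist_processSigma eaves 0))).trans ?_
      refine lintegral_congr fun ω => ?_
      rw [h.nodes_poisson.lintegral_atCount (hAm m _) (hAv m _), hAmean]
      rfl
    simp_rw [hint]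
    exact h.eaves_poisson.tendsto_lintegral_gridRadius hL hE n

end Limits

/-! ### The geometric distribution -/

theorem tsum_natCast_mul_geometric_ratio {a b : ℝ} (ha : 0 < a) (hb : 0 < b) :
    ∑' n : ℕ, (n : ℝ≥0∞) * ENNReal.ofReal ((a / (a + b)) ^ n * (b / (a + b))) =
      ENNReal.ofReal (a / b) := by
  have hr : ‖a / (a + b)‖ < 1 := by
    rw [Real.norm_of_nonneg (by positivity)]
    exact (div_lt_one (by positivity)).2 (by linarith)
  have h := (hasSum_coe_mul_geometric_of_norm_lt_one hr).mul_right (b / (a + b))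
  have hv : a / (a + b) / (1 - a / (a + b)) ^ 2 * (b / (a + b)) = a / b := by
    have : a + b ≠ 0 := by positivity
    rw [one_sub_div this, add_sub_cancel_left]
    field_simp
  rw [hv] at h
  rw [← h.tsum_eq, ENNReal.ofReal_tsum_of_nonneg (fun n => by positivity) h.summable]
  refine tsum_congr fun n => ?_
  rw [mul_assoc, ENNReal.ofReal_mul n.cast_nonneg, ENNReal.ofReal_natCast]

/-- The value `⊤` is absent from the sum, hence the almost sure finiteness. -/
theorem lintegral_enat_eq_tsum {Ω : Type*} [MeasurableSpace Ω] {P : Measure Ω} {N : Ω → ℕ∞}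
    (hN : AEMeasurable N P) (hfin : ∀ᵐ ω ∂P, N ω ≠ ⊤) :
    ∫⁻ ω, (N ω : ℝ≥0∞) ∂P = ∑' n : ℕ, (n : ℝ≥0∞) * P {ω | N ω = n} := by
  have hs : ∀ n : ℕ, NullMeasurableSet {ω | N ω = n} P := fun n =>
    hN.nullMeasurableSet_preimage (MeasurableSet.of_discrete (s := {(n : ℕ∞)}))
  have hi : ∀ n : ℕ, AEMeasurable ({ω | N ω = n}.indicator (1 : Ω → ℝ≥0∞)) P := fun n =>
    aemeasurable_one.indicator₀ (hs n)
  have hsum : ∀ᵐ ω ∂P, (N ω : ℝ≥0∞) =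
      ∑' n : ℕ, (n : ℝ≥0∞) * {ω | N ω = n}.indicator 1 ω := by
    filter_upwards [hfin] with ω hω
    obtain ⟨k, hk⟩ := ENat.ne_top_iff_exists.1 hω
    rw [tsum_eq_single k]
    · simp [← hk]
    · intro n hn
      have : ω ∉ {ω | N ω = n} := fun h => hn (by exact_mod_cast (hk.trans h).symm)
      rw [indicator_of_notMem this, mul_zero]
  rw [lintegral_congr_ae hsum, lintegral_tsum fun n =>
    (hi n).const_mul _]
  refine tsum_congr fun n => ?_
  rw [lintegral_const_mul'' _ (hi n),
    lintegral_indicator_one₀ (hs n)]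

/-! ### Palm means -/

section Palm

theorem tsum_subtype_indicator_one {X : Type*} (S A : Set X) :
    ∑' x : S, {z : S | (z : X) ∈ A}.indicator (fun _ => (1 : ℝ≥0∞)) x =
      ((S ∩ A).encard : ℝ≥0∞) := by
  rw [← ENNReal.tsum_set_one, tsum_subtype (S ∩ A) (fun _ => (1 : ℝ≥0∞)), ← indicator_indicator,
    ← tsum_subtype S]
  rfl

/-- Sorting the points by their mark reduces the Palm mean to the already computed expected numbers
of points of each degree. -/
theorem tsum_subtype_indicator_enat {X : Type*} (S B : Set X) (N : X → ℕ∞)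
    (hN : ∀ x ∈ S, N x ≠ ⊤) :
    ∑' x : S, {z : S | (z : X) ∈ B}.indicator (fun z => (N z : ℝ≥0∞)) x =
      ∑' n : ℕ, (n : ℝ≥0∞) * (({x | x ∈ S ∩ B ∧ N x = n} : Set X).encard : ℝ≥0∞) := by
  have hx : ∀ x : S, {z : S | (z : X) ∈ B}.indicator (fun z => (N z : ℝ≥0∞)) x =
      ∑' n : ℕ, (n : ℝ≥0∞) *
        {z : S | (z : X) ∈ {y | y ∈ B ∧ N y = n}}.indicator (fun _ => (1 : ℝ≥0∞)) x := by
    intro x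
    obtain ⟨k, hk⟩ := ENat.ne_top_iff_exists.1 (hN x x.2)
    rw [tsum_eq_single k]
    · by_cases hB : (x : X) ∈ B <;> simp [hB, ← hk]
    · intro n hn
      rw [indicator_of_notMem, mul_zero]
      rintro ⟨_, h⟩
      exact hn (by exact_mod_cast (hk.trans h).symm)
  simp_rw [hx]
  rw [ENNReal.tsum_comm]
  refine tsum_congr fun n => ?_
  rw [ENNReal.tsum_mul_left, tsum_subtype_indicator_one]
  congr 3
  ext y
  simp only [mem_inter_iff, mem_ofPred_eq, and_assoc]

variable {Ω : Type*} [MeasurableSpace Ω] {P : Measure Ω} {d : ℕ} {lam : ℝ}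
  {Φ : Ω → Set (Space d)} {B : Set (Space d)}

/-- Replaces a graph property by a geometric one; the two integrands agree almost surely, so no
measurability is required. -/
theorem palmProb_eq_of_ae {p : (ω : Ω) → Φ ω → Prop} {q : Ω → Space d → Prop}
    (hpq : ∀ᵐ ω ∂P, ∀ x : Φ ω, p ω x ↔ q ω x) :
    palmProb P lam Φ B p = (∫⁻ ω, (({x | x ∈ Φ ω ∩ B ∧ q ω x} : Set (Space d)).encard : ℝ≥0∞) ∂P) /
      (ENNReal.ofReal lam * volume B) := by
  rw [palmProb, palmMean]
  congr 1
  refine lintegral_congr_ae ?_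
  filter_upwards [hpq] with ω hω
  have hset : ({x | x ∈ Φ ω ∩ B ∧ q ω x} : Set (Space d)) = Φ ω ∩ {x | x ∈ B ∧ q ω x} := by
    ext y
    simp only [mem_inter_iff, mem_ofPred_eq, and_assoc]
  rw [hset, ← tsum_subtype_indicator_one]
  refine tsum_congr fun x => ?_
  rw [indicator_indicator]
  congr 1
  ext z
  exact and_congr_right fun _ => hω z

end Palm

/-! ### The out-degree of the typical node and of the origin -/

/-- Almost surely, the out-degree in the basic graph counts the nodes that are nearer than the
nearest eavesdropper. -/
theorem IsPoissonModel.ae_outDegree_eq {Ω : Type*} [MeasurableSpace Ω] {P : Measure Ω}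
    {lamL lamE : ℝ} {nodes eaves : Ω → Set (Space 2)} (h : IsPoissonModel P lamL lamE nodes eaves)
    (hL : 0 < lamL) (hE : 0 < lamE) {power noise : ℝ} (hpower : 0 < power) (hnoise : 0 < noise)
    {g : ℝ → ℝ} (hg : IsPathLossGain g) :
    ∀ᵐ ω ∂P, ∀ x : nodes ω, outDegree (basicISGraph power noise g (nodes ω) (eaves ω)) x =
      secureDegree (nodes ω) (eaves ω) x := by
  filter_upwards [h.ae_disjoint hL.le hE.le, h.eaves_poisson.ae_nonempty hE,
    h.eaves_poisson.ae_locallyFinite] with ω hdisj hne hfin x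
  exact outDegree_basicISGraph hpower hnoise hg hne hfin x (disjoint_left.1 hdisj x.2)

theorem IsPoissonModel.ae_outDegree_originGraph_eq {Ω : Type*} [MeasurableSpace Ω] {P : Measure Ω}
    {lamL lamE : ℝ} {nodes eaves : Ω → Set (Space 2)} (h : IsPoissonModel P lamL lamE nodes eaves)
    (hE : 0 < lamE) {power noise : ℝ} (hpower : 0 < power) (hnoise : 0 < noise)
    {g : ℝ → ℝ} (hg : IsPathLossGain g) :
    ∀ᵐ ω ∂P, outDegree (originGraph power noise g (nodes ω) (eaves ω)) (originNode (nodes ω)) =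
      secureDegree (nodes ω) (eaves ω) 0 := by
  filter_upwards [h.eaves_poisson.ae_notMem hE.le 0, h.eaves_poisson.ae_nonempty hE,
    h.eaves_poisson.ae_locallyFinite] with ω h0 hne hfin
  rw [originGraph, outDegree_basicISGraph hpower hnoise hg hne hfin _ h0]
  exact secureDegree_insert _ _ _

theorem mainTheorem3 {Ω : Type*} [MeasurableSpace Ω] (P : Measure Ω) [IsProbabilityMeasure P]
    (lamL lamE : ℝ) (hlamL : 0 < lamL) (hlamE : 0 < lamE)
    (nodes eaves : Ω → Set (Space 2)) (hmodel : IsPoissonModel P lamL lamE nodes eaves)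
    (power noise : ℝ) (hpower : 0 < power) (hnoise : 0 < noise)
    (g : ℝ → ℝ) (hg : IsPathLossGain g) :
    -- the typical node in the sense of Palm theory
    (∀ B : Set (Space 2), MeasurableSet B → volume B ≠ 0 → volume B ≠ ⊤ →
      (∀ n : ℕ,
        palmProb P lamL nodes B
          (fun ω x => outDegree (basicISGraph power noise g (nodes ω) (eaves ω)) x = n) =
        ENNReal.ofReal ((lamL / (lamL + lamE)) ^ n * (lamE / (lamL + lamE)))) ∧
      palmMean P lamL nodes B
          (fun ω x => (outDegree (basicISGraph power noise g (nodes ω) (eaves ω)) x : ℝ≥0∞)) =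
        ENNReal.ofReal (lamL / lamE) ∧
      palmProb P lamL nodes B
          (fun ω x => OutIsolated (basicISGraph power noise g (nodes ω) (eaves ω)) x) =
        ENNReal.ofReal (lamE / (lamL + lamE))) ∧
    -- the node at the origin, added to the process of legitimate nodes
    (AEMeasurable (fun ω =>
        outDegree (originGraph power noise g (nodes ω) (eaves ω)) (originNode (nodes ω))) P ∧
      (∀ n : ℕ,
        P {ω | outDegree (originGraph power noise g (nodes ω) (eaves ω))
          (originNode (nodes ω)) = n} =
        ENNReal.ofReal ((lamL / (lamL + lamE)) ^ n * (lamE / (lamL + lamE)))) ∧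
      ∫⁻ ω, (outDegree (originGraph power noise g (nodes ω) (eaves ω))
          (originNode (nodes ω)) : ℝ≥0∞) ∂P =
        ENNReal.ofReal (lamL / lamE) ∧
      P {ω | OutIsolated (originGraph power noise g (nodes ω) (eaves ω))
          (originNode (nodes ω))} =
        ENNReal.ofReal (lamE / (lamL + lamE))) := by

  constructor
  · intro B hB hB0 hBtop
    have hdeg := hmodel.ae_outDegree_eq hlamL hlamE hpower hnoise hg
    have hc0 : ENNReal.ofReal lamL * volume B ≠ 0 :=
      mul_ne_zero (ENNReal.ofReal_pos.2 hlamL).ne' hB0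
    have hctop : ENNReal.ofReal lamL * volume B ≠ ⊤ :=
      ENNReal.mul_ne_top ENNReal.ofReal_ne_top hBtop
    have hlaw := hmodel.lintegral_encard_pointsOfDegree hlamL hlamE hB hBtop
    have hprob : ∀ n : ℕ, palmProb P lamL nodes B
        (fun ω x => outDegree (basicISGraph power noise g (nodes ω) (eaves ω)) x = n) =
        ENNReal.ofReal ((lamL / (lamL + lamE)) ^ n * (lamE / (lamL + lamE))) := by
      intro n
      rw [palmProb_eq_of_ae (q := fun ω x => secureDegree (nodes ω) (eaves ω) x = n)]
      · refine (congrArg (· / (ENNReal.ofReal lamL * volume B)) (hlaw n).2).trans ?_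
        rw [mul_comm, ENNReal.mul_div_cancel_right hc0 hctop]
      · filter_upwards [hdeg] with ω hω x
        rw [hω x]
    refine ⟨hprob, ?_, ?_⟩
    · have hmean : ∀ᵐ ω ∂P, ∑' x : nodes ω, {z : nodes ω | (z : Space 2) ∈ B}.indicator
          (fun x => (outDegree (basicISGraph power noise g (nodes ω) (eaves ω)) x : ℝ≥0∞)) x =
          ∑' n : ℕ, (n : ℝ≥0∞) *
            ((pointsOfDegree (nodes ω) (eaves ω) B n).encard : ℝ≥0∞) := by
        filter_upwards [hdeg, hmodel.nodes_poisson.ae_locallyFinite] with ω hω hfin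
        simp_rw [hω]
        exact tsum_subtype_indicator_enat _ _ _ fun x _ => secureDegree_ne_top hfin _ _
      rw [palmMean, lintegral_congr_ae hmean,
        lintegral_tsum fun n => (hlaw n).1.const_mul _,
        ← tsum_natCast_mul_geometric_ratio hlamL hlamE]
      simp_rw [fun n : ℕ => lintegral_const_mul'' (n : ℝ≥0∞) (hlaw n).1, fun n => (hlaw n).2,
        fun n : ℕ => mul_left_comm (n : ℝ≥0∞)]
      rw [ENNReal.tsum_mul_left, mul_comm, ENNReal.mul_div_cancel_right hc0 hctop]
    -- Out-isolation is degree zero, so this is the case `n = 0` of the law.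
    · simp_rw [outIsolated_iff]
      simpa using hprob 0
  · have hdeg := hmodel.ae_outDegree_originGraph_eq hlamE hpower hnoise hg
    obtain ⟨hae, hlaw⟩ := hmodel.measure_secureDegree_zero_eq hlamL hlamE
    have hprob : ∀ n : ℕ, P {ω | outDegree (originGraph power noise g (nodes ω) (eaves ω))
        (originNode (nodes ω)) = n} =
        ENNReal.ofReal ((lamL / (lamL + lamE)) ^ n * (lamE / (lamL + lamE))) := by
      intro n
      rw [← hlaw n]
      refine measure_congr ?_
      filter_upwards [hdeg] with ω hω
      exact congrArg (· = (n : ℕ∞)) hω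
    refine ⟨hae.congr (hdeg.mono fun ω hω => hω.symm), hprob, ?_, ?_⟩
    · rw [lintegral_congr_ae (hdeg.mono fun ω hω => congrArg ENat.toENNReal hω),
        lintegral_enat_eq_tsum hae, ← tsum_natCast_mul_geometric_ratio hlamL hlamE]
      · simp_rw [hlaw]
      · filter_upwards [hmodel.nodes_poisson.ae_locallyFinite] with ω hfin
        exact secureDegree_ne_top hfin _ _
    · simp_rw [outIsolated_iff]
      simpa using hprob 0
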